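/- For a compact metric space $(X,d)$ and $\varepsilon>0$, a continuous map $f:X\to Y$ to a topological space is called an $\varepsilon$-embedding if $\operatorname{Diam} f^{-1}(y)\le\varepsilon$ for all $y\in Y$, and $\mathrm{Widim}_\varepsilon(X,d)$ is the minimum integer $m\ge 0$ such that there exist an $m$-dimensional polyhedron $P$ (the underlying space of a finite simplicial complex) and an $\varepsilon$-embedding $X\to P$. Let $1\le p<q\le\infty$, let $B_{\ell^p}(\mathbb{R}^n)=\{x\in\mathbb{R}^n : \sum_{k=1}^n|x_k|^p\le 1\}$, let $d_{\ell^q}$ be the $\ell^q$-distance on $\mathbb{R}^n$ (the maximum distance if $q=\infty$), and define $r$ by $1/r=1/p-1/q$ (with $1/\infty=0$). Write $W_n(\varepsilon)=\mathrm{Widim}_\varepsilon(B_{\ell^p}(\mathbb{R}^n),d_{\ell^q})$, and let $\log 0=-\infty$. Then, for every $\varepsilon>0$, $W_n(\varepsilon)$ is monotone non-decreasing in $n$ and has an upper bound independent of $n$, so that $\lim_{n\to\infty}\log W_n(\varepsilon)$ exists in $[-\infty,\infty)$, and \[ \lim_{\varepsilon\to 0}\left(\lim_{n\to\infty}\frac{\log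 \mathrm{Widim}_\varepsilon(B_{\ell^p}(\mathbb{R}^n),d_{\ell^q})}{|\log\varepsilon|}\right)=r=\frac{pq}{q-p}, \] where $pq/(q-p)$ is understood as $p$ when $q=\infty$; the inner limit exists for every $\varepsilon>0$ with $\varepsilon\ne 1$. -/

import Mathlib

open Filter Topology
open scoped ENNReal

/-- `K` is a finite simplicial complex of dimension exactly `n`: its largest simplices have `n + 1`
vertices. Its space `K.space` is then an `n`-dimensional (compact) polyhedron. -/
def IsPolyhedralOfDim {N : ℕ} (K : Geometry.SimplicialComplex ℝ (EuclideanSpace ℝ (Fin N)))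
    (n : ℕ) : Prop :=
  K.faces.Finite ∧ (∃ s ∈ K.faces, s.card = n + 1) ∧ ∀ s ∈ K.faces, s.card ≤ n + 1

/-- `f` is an `ε`-embedding: it is continuous and each of its fibres has diameter at most `ε`. -/
def IsEpsEmbedding {X Y : Type*} [MetricSpace X] [TopologicalSpace Y] (ε : ℝ) (f : X → Y) : Prop :=
  Continuous f ∧ ∀ y : Y, Metric.ediam (f ⁻¹' {y}) ≤ ENNReal.ofReal ε

/-- The width dimension of a metric space `X` at scale `ε`: the least `n` such that there are an
`n`-dimensional polyhedron `P` and an `ε`-embedding `X → P` (and `⊤` if there is no such `n`). -/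
noncomputable def widim (X : Type*) [MetricSpace X] (ε : ℝ) : ℕ∞ :=
  sInf {m : ℕ∞ | ∃ n : ℕ, m = n ∧
    ∃ (N : ℕ) (K : Geometry.SimplicialComplex ℝ (EuclideanSpace ℝ (Fin N))) (f : X → K.space),
      IsPolyhedralOfDim K n ∧ IsEpsEmbedding ε f}

/-- The unit ball `{x ∈ ℝⁿ | ∑ |x_k| ^ p ≤ 1}`, as a subset of `ℝⁿ` with the `ℓ^q`-distance. -/
def lpBall (p : ℝ) (q : ℝ≥0∞) (n : ℕ) : Set (PiLp q (fun _ : Fin n => ℝ)) :=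
  {x | ∑ k, |x k| ^ p ≤ 1}

/-- The width dimension of the `ℓ^p` unit ball of `ℝⁿ` with respect to the `ℓ^q`-distance. -/
noncomputable def widimBall (p : ℝ) (q : ℝ≥0∞) [Fact (1 ≤ q)] (n : ℕ) (ε : ℝ) : ℕ∞ :=
  widim (lpBall p q n) ε

/-! Both bounds are explicit and agree up to a constant factor: `W_n(ε)` is at most `(ε/2)^(-r)` for
every `n`, and at least `ε^(-r)/2` for some `n` once `ε` is small. Dividing logarithms by `|log ε|`
squeezes the limit to `r`.

Lower bound (`le_widimBall`): the `ℓ^p` ball contains the `ℓ^q` ball of radius `n^(-1/r)`, and a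
ball of radius greater than `ε` in an `n`-dimensional normed space has width dimension at least `n`.
For the latter, a smooth approximate left inverse `g` of an `ε`-embedding `f` into a polyhedron of
smaller dimension misses some small vector `a`, while Brouwer's theorem for `x ↦ x - g (f x) + a`
produces a point with `g (f x) = a`. Brouwer's theorem is obtained from the Milnor-Rogers volume
argument.

Upper bound (`widimBall_le`): soft thresholding at level `δ` leaves at most `δ^(-p)` nonzero
coordinates and moves points of the `ℓ^p` ball by at most `δ^(1 - p/q)` in `ℓ^q`; the result is
encoded in a skeleton of a simplex. -/

/-! ### Determinants and perturbations of the identity -/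

section Brouwer

open MeasureTheory Metric Set Polynomial Module

/-- Values at `1` of polynomials of bounded degree are a fixed linear combination of values at small
positive nodes. -/
theorem exists_eval_one_eq_sum (n : ℕ) {b : ℝ} (hb : 0 < b) :
    ∃ (s : Finset ℝ) (c : ℝ → ℝ), (∀ t ∈ s, 0 < t ∧ t < b) ∧
      ∀ P : ℝ[X], P.natDegree ≤ n → P.eval 1 = ∑ t ∈ s, P.eval t * c t := by
  obtain ⟨s, hs, hcard⟩ := (Ioo_infinite hb).exists_subset_card_eq (n + 1)
  refine ⟨s, fun t => (Lagrange.basis s id t).eval 1, fun t ht => hs ht, fun P hP => ?_⟩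
  have h := Lagrange.eq_interpolate (s := s) (v := id) (f := P) (Set.injOn_id _)
    ((degree_le_natDegree).trans_lt (by rw [hcard]; exact_mod_cast Nat.lt_succ_of_le hP))
  conv_lhs => rw [h]
  simp [Lagrange.interpolate_apply, eval_finsetSum]

theorem exists_polynomial_det_id_add_smul {E : Type*} [NormedAddCommGroup E] [NormedSpace ℝ E]
    [FiniteDimensional ℝ E] (A : E →L[ℝ] E) :
    ∃ P : ℝ[X], P.natDegree ≤ finrank ℝ E ∧
      ∀ t : ℝ, P.eval t = (ContinuousLinearMap.id ℝ E + t • A).det := by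
  classical
  let b := Module.finBasis ℝ E
  let M := LinearMap.toMatrix b b (A : E →ₗ[ℝ] E)
  refine ⟨((X : ℝ[X]) • M.map C + (1 : Matrix _ _ ℝ).map C).det, ?_, fun t => ?_⟩
  · simpa using natDegree_det_X_add_C_le M 1
  · have h1 : (ContinuousLinearMap.id ℝ E + t • A).det =
        (LinearMap.toMatrix b b (LinearMap.id + t • (A : E →ₗ[ℝ] E))).det := by
      rw [LinearMap.det_toMatrix]; rfl
    rw [h1, ← coe_evalRingHom, RingHom.map_det]
    congr 1
    ext i j
    simp [M, Matrix.one_apply, add_comm, apply_ite]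
    ring

variable {E : Type*} [NormedAddCommGroup E] [NormedSpace ℝ E]

/-- The determinant is `1` at time `0`. A zero at some `s ≤ t` would give a kernel vector with `‖v‖
= s * ‖A v‖ ≤ t * K * ‖v‖ < ‖v‖`. -/
theorem det_id_add_smul_pos [FiniteDimensional ℝ E] {A : E →L[ℝ] E} {K t : ℝ} (hA : ‖A‖ ≤ K)
    (ht : 0 ≤ t) (htK : t * K < 1) : 0 < (ContinuousLinearMap.id ℝ E + t • A).det := by
  by_contra! hneg
  have hcont : ContinuousOn (fun s : ℝ => (ContinuousLinearMap.id ℝ E + s • A).det) (Icc 0 t) := by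
    have : Continuous fun s : ℝ => (ContinuousLinearMap.id ℝ E + s • A).det :=
      ContinuousLinearMap.continuous_det.comp (by fun_prop)
    exact this.continuousOn
  obtain ⟨s, hs, hs0⟩ := intermediate_value_Icc' ht hcont
    (show (0 : ℝ) ∈ Icc _ _ from ⟨hneg, by simp [ContinuousLinearMap.det]⟩)
  have hker := LinearMap.bot_lt_ker_of_det_eq_zero
    (f := ((ContinuousLinearMap.id ℝ E + s • A : E →L[ℝ] E) : E →ₗ[ℝ] E)) hs0
  obtain ⟨v, hv, hv0⟩ := (Submodule.ne_bot_iff _).1 hker.ne'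
  have hv' : v + s • A v = 0 := hv
  have h1 : ‖v‖ = s * ‖A v‖ := by
    rw [eq_neg_of_add_eq_zero_left hv', norm_neg, norm_smul, Real.norm_of_nonneg hs.1]
    rw [← eq_neg_of_add_eq_zero_left hv']
  have h2 : ‖A v‖ ≤ K * ‖v‖ := (A.le_opNorm v).trans (by gcongr)
  have h3 : 0 < ‖v‖ := norm_pos_iff.2 hv0
  have hK : 0 ≤ K := (norm_nonneg _).trans hA
  have : ‖v‖ ≤ t * K * ‖v‖ := by
    calc ‖v‖ = s * ‖A v‖ := h1
      _ ≤ t * (K * ‖v‖) := mul_le_mul hs.2 h2 (norm_nonneg _) ht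
      _ = _ := by ring
  nlinarith

/-- A map that is Lipschitz on a closed ball and vanishes on and outside the bounding sphere is
Lipschitz. -/
theorem lipschitzWith_of_eqOn_zero {F : Type*} [NormedAddCommGroup F] {u : E → F} {R : ℝ}
    {K : NNReal}
    (hu : LipschitzOnWith K u (closedBall 0 R)) (h0 : ∀ x, R ≤ ‖x‖ → u x = 0) :
    LipschitzWith K u := by
  have key : ∀ x y, ‖x‖ ≤ R → R < ‖y‖ → dist (u x) (u y) ≤ K * dist x y := by
    intro x y hx hy
    -- The segment crosses the sphere at `z`, where `u` vanishes, and `z` is no farther from `x`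
    -- than `y` is.
    obtain ⟨z, hz, hzR⟩ := (convex_segment x y).isPreconnected.intermediate_value
      (left_mem_segment ℝ x y) (right_mem_segment ℝ x y) continuous_norm.continuousOn ⟨hx, hy.le⟩
    have h1 := hu.dist_le_mul x (by simpa using hx) z (by simpa using hzR.le)
    rw [h0 z hzR.ge] at h1
    rw [h0 y hy.le]
    refine h1.trans ?_
    have := dist_add_dist_of_mem_segment hz
    gcongr
    linarith [dist_nonneg (x := z) (y := y)]
  refine LipschitzWith.of_dist_le_mul fun x y => ?_
  rcases le_or_gt ‖x‖ R with hx | hx <;> rcases le_or_gt ‖y‖ R with hy | hy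
  · exact hu.dist_le_mul x (by simpa using hx) y (by simpa using hy)
  · exact key x y hx hy
  · rw [dist_comm, dist_comm x]; exact key y x hy hx
  · rw [h0 x hx.le, h0 y hy.le, dist_self]; positivity

/-- A small Lipschitz perturbation of the identity that is supported in a ball permutes the ball. -/
theorem image_ball_id_add_smul [CompleteSpace E] {u : E → E} {R : ℝ} {K : NNReal}
    (hu : LipschitzWith K u) (h0 : ∀ x, R ≤ ‖x‖ → u x = 0) {t : ℝ} (ht : 0 ≤ t) (htK : t * K < 1) :
    InjOn (fun x => x + t • u x) (ball 0 R) ∧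
      (fun x => x + t • u x) '' ball 0 R = ball 0 R := by
  set Φ : E → E := fun x => x + t • u x with hΦ
  have hout : ∀ x, R ≤ ‖x‖ → Φ x = x := fun x hx => by simp [hΦ, h0 x hx]
  -- `Φ` differs from the identity by a contraction, hence is bijective; fixing the outside of the
  -- ball, it must permute the inside.
  have happ : ApproximatesLinearOn Φ ((ContinuousLinearEquiv.refl ℝ E : E ≃L[ℝ] E) : E →L[ℝ] E)
      univ (Real.toNNReal t * K) := by
    intro x _ y _
    have h := hu.dist_le_mul x y
    rw [dist_eq_norm, dist_eq_norm] at h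
    have : Φ x - Φ y - ((ContinuousLinearEquiv.refl ℝ E : E ≃L[ℝ] E) : E →L[ℝ] E) (x - y)
        = t • (u x - u y) := by
      simp [hΦ, smul_sub]; abel
    rw [this, norm_smul, Real.norm_of_nonneg ht]
    calc t * ‖u x - u y‖ ≤ t * (K * ‖x - y‖) := mul_le_mul_of_nonneg_left h ht
      _ = _ := by rw [← mul_assoc, NNReal.coe_mul, Real.coe_toNNReal _ ht]
  have hc : Subsingleton E ∨ (Real.toNNReal t * K : NNReal) <
      ‖((ContinuousLinearEquiv.refl ℝ E).symm : E →L[ℝ] E)‖₊⁻¹ := by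
    rcases subsingleton_or_nontrivial E with h | h
    · exact Or.inl h
    · right
      have : ‖((ContinuousLinearEquiv.refl ℝ E).symm : E →L[ℝ] E)‖₊ = 1 := by
        apply NNReal.eq
        exact ContinuousLinearMap.norm_id
      rw [this, inv_one]
      rw [← NNReal.coe_lt_coe, NNReal.coe_mul, Real.coe_toNNReal _ ht]
      exact_mod_cast htK
  have hinj : Function.Injective Φ := injOn_univ.1 (happ.injOn hc)
  have hsurj : Function.Surjective Φ := happ.surjective hc
  refine ⟨hinj.injOn, Subset.antisymm ?_ ?_⟩
  · rintro _ ⟨x, hx, rfl⟩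
    by_contra hn
    have hn' : R ≤ ‖Φ x‖ := by simpa using hn
    have := hinj (hout _ hn')
    rw [this] at hn
    exact hn hx
  · intro y hy
    obtain ⟨x, rfl⟩ := hsurj y
    refine ⟨x, ?_, rfl⟩
    by_contra hn
    have hn' : R ≤ ‖x‖ := by simpa using hn
    rw [hout x hn'] at hy
    exact hn hy

end Brouwer

/-! ### The no-retraction theorem and zeros of maps that are the identity near infinity -/

section NoRetraction

open MeasureTheory Metric Set Module

variable {E : Type*} [NormedAddCommGroup E] [InnerProductSpace ℝ E] [FiniteDimensional ℝ E]

/-- There is no `C¹` retraction of a closed ball onto its bounding sphere. -/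
theorem no_contDiff_retraction {r : E → E} {R : ℝ} (hR : 0 < R) (hr : ContDiff ℝ 1 r)
    (hsph : ∀ x, ‖x‖ ≤ R → ‖r x‖ = R) (hid : ∀ x, ‖x‖ = R → r x = x) : False := by
  borelize E
  let μ : Measure E := Measure.addHaar
  let u : E → E := fun x => if ‖x‖ ≤ R then r x - x else 0
  let A : E → E →L[ℝ] E := fun x => fderiv ℝ r x - ContinuousLinearMap.id ℝ E
  have hAc : Continuous A := (hr.continuous_fderiv one_ne_zero).sub continuous_const
  obtain ⟨K, hK⟩ := (isCompact_closedBall (0 : E) R).exists_bound_of_continuousOn hAc.continuousOn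
  have hK0 : 0 ≤ K := (norm_nonneg _).trans (hK 0 (by simpa using hR.le))
  have hd : ∀ x, HasFDerivAt (fun x => r x - x) (A x) x := fun x =>
    ((hr.differentiable one_ne_zero x).hasFDerivAt).sub (hasFDerivAt_id x)
  have hu0 : ∀ x, R ≤ ‖x‖ → u x = 0 := by
    intro x hx
    by_cases h : ‖x‖ ≤ R
    · simp [u, h, hid x (le_antisymm h hx)]
    · simp [u, h]
  have hlip : LipschitzWith ⟨K, hK0⟩ u := by
    refine lipschitzWith_of_eqOn_zero ?_ hu0
    have h1 : LipschitzOnWith ⟨K, hK0⟩ (fun x => r x - x) (closedBall 0 R) :=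
      (convex_closedBall (0 : E) R).lipschitzOnWith_of_nnnorm_hasFDerivWithin_le
        (fun x _ => (hd x).hasFDerivWithinAt) (fun x hx => hK x hx)
    intro x hx y hy
    have := h1 hx hy
    simpa [u, mem_closedBall_zero_iff.1 hx, mem_closedBall_zero_iff.1 hy] using this
  -- Nodes below `1 / (K + 1)` satisfy `t * K < 1`, where the perturbation permutes the ball and the
  -- determinant integrates to its volume. Interpolation carries this value to `t = 1`, where the
  -- determinant vanishes.
  obtain ⟨s, c, hs, hint⟩ := exists_eval_one_eq_sum (finrank ℝ E)
    (show (0 : ℝ) < 1 / (K + 1) by positivity)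
  have hdetc : ∀ t : ℝ, Continuous fun x => (ContinuousLinearMap.id ℝ E + t • A x).det := fun t =>
    ContinuousLinearMap.continuous_det.comp (by fun_prop)
  have hintg : ∀ t : ℝ, IntegrableOn
      (fun x => (ContinuousLinearMap.id ℝ E + t • A x).det) (ball 0 R) μ := fun t =>
    ((hdetc t).continuousOn.integrableOn_compact (isCompact_closedBall 0 R)).mono_set
      ball_subset_closedBall
  have hvol : ∀ t ∈ s, ∫ x in ball 0 R, (ContinuousLinearMap.id ℝ E + t • A x).det ∂μ
      = μ.real (ball 0 R) := by
    intro t ht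
    obtain ⟨ht0, ht1⟩ := hs t ht
    have htK : t * K < 1 := by
      rw [lt_div_iff₀ (by positivity)] at ht1
      nlinarith
    obtain ⟨hinj, him⟩ := image_ball_id_add_smul hlip hu0 ht0.le htK
    have hder : ∀ x ∈ ball (0 : E) R, HasFDerivWithinAt (fun x => x + t • u x)
        (ContinuousLinearMap.id ℝ E + t • A x) (ball 0 R) x := by
      intro x hx
      have h1 : HasFDerivAt (fun x => x + t • (r x - x)) (ContinuousLinearMap.id ℝ E + t • A x) x :=
        (hasFDerivAt_id x).add ((hd x).const_smul t)
      refine h1.hasFDerivWithinAt.congr (fun y hy => ?_) ?_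
      · simp [u, (mem_ball_zero_iff.1 hy).le]
      · simp [u, (mem_ball_zero_iff.1 hx).le]
    have h := integral_image_eq_integral_abs_det_fderiv_smul μ measurableSet_ball hder hinj
      (fun _ => (1 : ℝ))
    rw [him] at h
    simp only [integral_const, smul_eq_mul, mul_one, measureReal_restrict_apply_univ] at h
    rw [h]
    refine setIntegral_congr_fun measurableSet_ball fun x hx => ?_
    exact (abs_of_pos (det_id_add_smul_pos (hK x (ball_subset_closedBall hx)) ht0.le htK)).symm
  have hdet : ∀ x ∈ ball (0 : E) R, (ContinuousLinearMap.id ℝ E + (1 : ℝ) • A x).det = 0 := by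
    intro x hx
    have hA1 : ContinuousLinearMap.id ℝ E + (1 : ℝ) • A x = fderiv ℝ r x := by simp [A]
    rw [hA1]
    have hrd : HasFDerivAt r (fderiv ℝ r x) x := (hr.differentiable one_ne_zero x).hasFDerivAt
    -- `‖r‖²` is constant near `x`, so the range of the derivative is orthogonal to `r x ≠ 0` and
    -- the derivative is not onto.
    have h1 := hrd.norm_sq
    have h2 : (fun y => ‖r y‖ ^ 2) =ᶠ[𝓝 x] fun _ => R ^ 2 := by
      filter_upwards [isOpen_ball.mem_nhds hx] with y hy
      rw [hsph y (mem_ball_zero_iff.1 hy).le]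
    have h3 := h1.unique ((hasFDerivAt_const (R ^ 2) x).congr_of_eventuallyEq h2)
    by_contra hne
    have hu : IsUnit (LinearMap.det (fderiv ℝ r x : E →ₗ[ℝ] E)) := isUnit_iff_ne_zero.2 hne
    obtain ⟨v, hv⟩ := (LinearEquiv.ofIsUnitDet (v := Module.finBasis ℝ E) (v' := Module.finBasis ℝ E)
      (f := (fderiv ℝ r x : E →ₗ[ℝ] E)) (by rwa [LinearMap.det_toMatrix])).surjective (r x)
    have hv' : fderiv ℝ r x v = r x := hv
    have h4 := congrArg (fun L : E →L[ℝ] ℝ => L v) h3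
    simp [hv', hsph x (mem_ball_zero_iff.1 hx).le, hR.ne'] at h4
  choose P hPdeg hP using fun x => exists_polynomial_det_id_add_smul (A x)
  have hsum : ∀ x, (ContinuousLinearMap.id ℝ E + (1 : ℝ) • A x).det
      = ∑ t ∈ s, (ContinuousLinearMap.id ℝ E + t • A x).det * c t := by
    intro x
    simp only [← hP]
    exact hint _ (hPdeg x)
  have hc1 : ∑ t ∈ s, c t = 1 := by simpa using (hint 1 (by simp)).symm
  have htot : ∫ x in ball 0 R, (ContinuousLinearMap.id ℝ E + (1 : ℝ) • A x).det ∂μ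
      = μ.real (ball 0 R) := by
    simp only [hsum]
    rw [integral_finsetSum _ fun t _ => (hintg t).mul_const _]
    simp only [integral_mul_const]
    rw [Finset.sum_congr rfl fun t ht => by rw [hvol t ht], ← Finset.mul_sum, hc1, mul_one]
  rw [setIntegral_congr_fun measurableSet_ball hdet, integral_zero] at htot
  have : 0 < μ.real (ball (0 : E) R) :=
    ENNReal.toReal_pos (measure_ball_pos μ 0 hR).ne' measure_ball_lt_top.ne
  linarith

/-- A continuous map that is the identity outside of a ball has a zero. -/
theorem exists_eq_zero_of_eq_id_off_ball {F : E → E} (hF : Continuous F) {R : ℝ}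
    (hid : ∀ x, R ≤ ‖x‖ → F x = x) : ∃ x, F x = 0 := by
  by_contra! hne
  wlog hR : 0 < R generalizing R
  · exact this (R := 1) (fun x hx => hid x (by linarith)) one_pos
  obtain ⟨x₀, -, hx₀⟩ := (isCompact_closedBall (0 : E) R).exists_isMinOn ⟨0, by simpa using hR.le⟩
    hF.norm.continuousOn
  obtain ⟨δ, hδ, hδF⟩ : ∃ δ > 0, ∀ x, δ ≤ ‖F x‖ := by
    refine ⟨min R ‖F x₀‖, lt_min hR (norm_pos_iff.2 (hne _)), fun x => ?_⟩
    rcases le_or_gt ‖x‖ R with h | h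
    · exact (min_le_right _ _).trans (hx₀ (mem_closedBall_zero_iff.2 h))
    · rw [hid x h.le]; exact (min_le_left _ _).trans h.le
  have hcs : HasCompactSupport fun x => F x - x :=
    HasCompactSupport.of_support_subset_isCompact (isCompact_closedBall (0 : E) R) fun x hx => by
      by_contra hn
      exact hx (by simp [hid x (by simpa using (not_le.1 (by simpa using hn)).le)])
  have hcont : Continuous fun x => F x - x := hF.sub continuous_id
  have huc := hcs.uniformContinuous_of_continuous hcont
  obtain ⟨η, hη, hηu⟩ := Metric.uniformContinuous_iff.1 huc (δ / 2) (half_pos hδ)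
  obtain ⟨g, hg, hgu⟩ := hcont.exists_contDiff_dist_le_of_forall_mem_ball_dist_le hη
  have hg1 : ∀ x, x + g x ≠ 0 := by
    intro x hx
    have h1 := hgu x (δ / 2) fun y hy => (hηu hy).le
    rw [dist_eq_norm, show g x - (F x - x) = -(F x) + (x + g x) by abel, hx, add_zero,
      norm_neg] at h1
    linarith [hδF x]
  have hg0 : ∀ x, R + η ≤ ‖x‖ → g x = 0 := by
    intro x hx
    -- Tolerance `0` is allowed where `F y - y` vanishes on the whole `η`-ball, so `g` is exactly
    -- zero there; only the radius grows to `R + η`.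
    have h1 := hgu x 0 fun y hy => by
      have hyR : R ≤ ‖y‖ := by
        have := norm_sub_norm_le x y
        rw [mem_ball, dist_comm, dist_eq_norm] at hy
        linarith
      rw [hid y hyR, hid x (by linarith)]
      simp
    rw [hid x (by linarith), sub_self] at h1
    exact dist_le_zero.1 h1
  have hRη : 0 < R + η := by positivity
  have hG : ContDiff ℝ 1 fun x => x + g x := contDiff_id.add (hg.of_le (by exact_mod_cast le_top))
  refine no_contDiff_retraction (r := fun x => ((R + η) / ‖x + g x‖) • (x + g x)) hRη
    ((contDiff_const.div (hG.norm ℝ hg1) fun x => norm_ne_zero_iff.2 (hg1 x)).smul hG) ?_ ?_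
  · intro x _
    rw [norm_smul, norm_div, norm_norm, div_mul_cancel₀ _ (norm_ne_zero_iff.2 (hg1 x)),
      Real.norm_of_nonneg hRη.le]
  · intro x hx
    simp [hg0 x hx.ge, hx, hRη.ne']

end NoRetraction

/-! ### Brouwer's fixed point theorem -/

section BrouwerFixedPoint

open Metric Set Module

variable {E : Type*} [NormedAddCommGroup E] [NormedSpace ℝ E] [FiniteDimensional ℝ E]

/-- **Brouwer fixed point theorem** for a closed ball of a finite-dimensional normed space. -/
theorem exists_isFixedPt_of_mapsTo_closedBall {k : E → E} {ρ : ℝ} (hρ : 0 < ρ)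
    (hk : ContinuousOn k (closedBall 0 ρ)) (hmaps : MapsTo k (closedBall 0 ρ) (closedBall 0 ρ)) :
    ∃ x ∈ closedBall (0 : E) ρ, k x = x := by
  let π : E → E := fun x => (ρ / max ρ ‖x‖) • x
  have hmax : ∀ x : E, 0 < max ρ ‖x‖ := fun x => lt_max_of_lt_left hρ
  have hπc : Continuous π :=
    (continuous_const.div (by fun_prop) fun x => (hmax x).ne').smul continuous_id
  have hπ : ∀ x, π x ∈ closedBall (0 : E) ρ := by
    intro x
    rw [mem_closedBall_zero_iff, norm_smul, norm_div, Real.norm_of_nonneg hρ.le,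
      Real.norm_of_nonneg (hmax x).le, div_mul_eq_mul_div, div_le_iff₀ (hmax x)]
    gcongr
    exact le_max_right _ _
  have hπid : ∀ x, ‖x‖ ≤ ρ → π x = x := by
    intro x hx
    simp [π, max_eq_left hx, hρ.ne']
  -- The cutoff is `1` on the ball and `0` beyond radius `2 * ρ`, so `F` is the identity far out. A
  -- zero satisfies `x = φ x • k (π x)`, hence lies in the ball, where `φ x = 1` and `π x = x`.
  let φ : E → ℝ := fun x => max 0 (min 1 (2 - ‖x‖ / ρ))
  let F : E → E := fun x => x - φ x • k (π x)
  have hF : Continuous F :=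
    continuous_id.sub ((by fun_prop : Continuous φ).smul (hk.comp_continuous hπc hπ))
  have hφ : ∀ x, 2 * ρ ≤ ‖x‖ → φ x = 0 := by
    intro x hx
    have : 2 ≤ ‖x‖ / ρ := by rwa [le_div_iff₀ hρ]
    exact max_eq_left ((min_le_right _ _).trans (by linarith))
  let e : E ≃L[ℝ] EuclideanSpace ℝ (Fin (finrank ℝ E)) := toEuclidean
  obtain ⟨C, hC, hCe⟩ : ∃ C > 0, ∀ y, ‖y‖ ≤ C * ‖e.symm y‖ :=
    ⟨‖e.toContinuousLinearMap‖ + 1, by positivity, fun y => by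
      have := e.toContinuousLinearMap.le_opNorm (e.symm y)
      simp only [ContinuousLinearEquiv.coe_coe, ContinuousLinearEquiv.apply_symm_apply] at this
      nlinarith [norm_nonneg (e.symm y)]⟩
  obtain ⟨y, hy⟩ := exists_eq_zero_of_eq_id_off_ball (F := fun y => e (F (e.symm y)))
    (by fun_prop) (R := C * (2 * ρ)) (fun y hy => by
      have : 2 * ρ ≤ ‖e.symm y‖ := le_of_mul_le_mul_left (hy.trans (hCe y)) hC
      simp [F, hφ _ this])
  have hx0 : F (e.symm y) = 0 := by simpa using hy
  set x := e.symm y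
  have hx : x = φ x • k (π x) := sub_eq_zero.1 hx0
  have hφ0 : 0 ≤ φ x := le_max_left _ _
  have hkx : ‖k (π x)‖ ≤ ρ := mem_closedBall_zero_iff.1 (hmaps (hπ x))
  have hnorm : ‖x‖ ≤ φ x * ρ := by
    conv_lhs => rw [hx, norm_smul, Real.norm_of_nonneg hφ0]
    gcongr
  have hxρ : ‖x‖ ≤ ρ := by
    by_contra! hlt
    have h1 : 1 < ‖x‖ / ρ := by rwa [lt_div_iff₀ hρ, one_mul]
    have h2 : φ x ≤ 1 := max_le zero_le_one (min_le_left _ _)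
    nlinarith
  refine ⟨x, mem_closedBall_zero_iff.2 hxρ, ?_⟩
  have h1 : ‖x‖ / ρ ≤ 1 := by rwa [div_le_one hρ]
  have hφ1 : φ x = 1 := by
    simp only [φ]
    rw [min_eq_left (by linarith), max_eq_right zero_le_one]
  rw [hφ1, one_smul, hπid x hxρ] at hx
  exact hx.symm

end BrouwerFixedPoint

/-! ### Width dimension of balls from below -/

section LowerBound

open Metric Set Module
open scoped Manifold ContDiff

/-- A smooth image of a polyhedron of small dimension has dense complement. -/
theorem dense_compl_image_space {N k : ℕ}
    {K : Geometry.SimplicialComplex ℝ (EuclideanSpace ℝ (Fin N))} (hK : IsPolyhedralOfDim K k)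
    {F : Type*} [NormedAddCommGroup F] [NormedSpace ℝ F] [FiniteDimensional ℝ F]
    (hk : k < finrank ℝ F) {g : EuclideanSpace ℝ (Fin N) → F} (hg : ContDiff ℝ 1 g) :
    Dense (g '' K.space)ᶜ := by
  refine dense_compl_of_dimH_lt_finrank (lt_of_le_of_lt (b := (k : ℝ≥0∞)) ?_
    (by exact_mod_cast hk))
  rw [Geometry.SimplicialComplex.space, image_iUnion₂, dimH_bUnion hK.1.countable]
  refine iSup₂_le fun s hs => ?_
  obtain ⟨v, hv⟩ := K.nonempty_of_mem_faces hs
  -- Each face lies in a translate of `V`, of dimension at most `k`, and `C¹` maps do not raise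
  -- Hausdorff dimension.
  let V := vectorSpan ℝ (s : Set (EuclideanSpace ℝ (Fin N)))
  have hsub : g '' convexHull ℝ (s : Set (EuclideanSpace ℝ (Fin N))) ⊆
      range fun x : V => g (v + x) := by
    rintro _ ⟨x, hx, rfl⟩
    have h1 : x -ᵥ v ∈ vectorSpan ℝ (s : Set (EuclideanSpace ℝ (Fin N))) := by
      rw [← direction_affineSpan]
      exact AffineSubspace.vsub_mem_direction (convexHull_subset_affineSpan _ hx)
        (subset_affineSpan ℝ _ hv)
    exact ⟨⟨x - v, h1⟩, by simp⟩
  have hdim : finrank ℝ V ≤ k := by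
    have hcard := hK.2.2 s hs
    have hpos : 0 < s.card := Finset.card_pos.2 ⟨v, hv⟩
    have h := (K.indep hs).finrank_vectorSpan (n := s.card - 1) (by simp; omega)
    rw [Subtype.range_coe_subtype] at h
    have h' : finrank ℝ V = s.card - 1 := h
    omega
  calc _ ≤ dimH (range fun x : V => g (v + x)) := dimH_mono hsub
    _ ≤ finrank ℝ V := by
      have hV : ContDiff ℝ 1 fun x : V => (x : EuclideanSpace ℝ (Fin N)) := V.subtypeL.contDiff
      exact (hg.comp (contDiff_const.add hV)).dimH_range_le
    _ ≤ k := by exact_mod_cast hdim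

variable {F : Type*} [NormedAddCommGroup F] [NormedSpace ℝ F]

/-- An `ε`-embedding of a compact set into Euclidean space has a smooth approximate left inverse. -/
theorem exists_contDiff_dist_le_of_isEpsEmbedding {S : Set F} [CompactSpace S] {N : ℕ} {ε ε' : ℝ}
    (hε : 0 ≤ ε) (hε' : ε < ε') {P : Set (EuclideanSpace ℝ (Fin N))} {f : S → P}
    (hf : IsEpsEmbedding ε f) :
    ∃ g : EuclideanSpace ℝ (Fin N) → F, ContDiff ℝ 1 g ∧
      ∀ x : S, dist (g (f x)) (x : F) ≤ ε' := by
  have hfc : Continuous fun x => (f x : EuclideanSpace ℝ (Fin N)) :=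
    continuous_subtype_val.comp hf.1
  -- Partition of unity: `g y` is to lie within `ε'` of the whole fibre over `y`, a convex
  -- condition. A point of the fibre over `y` also works for nearby `y'`, because the points of `S`
  -- at distance at least `ε'` from it have compact image missing `y`.
  obtain ⟨g, hg⟩ := exists_contMDiffMap_forall_mem_convex_of_local_const (n := 1)
    (I := 𝓘(ℝ, EuclideanSpace ℝ (Fin N))) (M := EuclideanSpace ℝ (Fin N))
    (t := fun y => ⋂ (x : S) (_ : (f x : EuclideanSpace ℝ (Fin N)) = y), closedBall (x : F) ε')
    (fun y => convex_iInter₂ fun x _ => convex_closedBall _ _) (fun y => by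
      obtain ⟨c, hc⟩ : ∃ c : F, ∀ x : S, (f x : EuclideanSpace ℝ (Fin N)) = y →
          dist c (x : F) < ε' := by
        by_cases hy : ∃ x₀ : S, (f x₀ : EuclideanSpace ℝ (Fin N)) = y
        · obtain ⟨x₀, hx₀⟩ := hy
          refine ⟨x₀, fun x hx => lt_of_le_of_lt ?_ hε'⟩
          have h := (edist_le_ediam_of_mem (s := f ⁻¹' {f x₀}) (x := x₀) (y := x) rfl
            (Subtype.ext (hx.trans hx₀.symm))).trans (hf.2 (f x₀))
          rwa [edist_dist, ENNReal.ofReal_le_ofReal_iff hε] at h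
        · exact ⟨0, fun x hx => (hy ⟨x, hx⟩).elim⟩
      refine ⟨c, ?_⟩
      have hcl : IsClosed ((fun x => (f x : EuclideanSpace ℝ (Fin N))) ''
          {x : S | ε' ≤ dist c (x : F)}) :=
        ((isClosed_le continuous_const (by fun_prop)).isCompact.image hfc).isClosed
      filter_upwards [hcl.isOpen_compl.mem_nhds (x := y) (by
        rintro ⟨x, hx, rfl⟩
        exact (hc x rfl).not_ge hx)] with y' hy'
      refine mem_iInter₂.2 fun x hx => ?_
      by_contra hn
      rw [mem_closedBall, not_le] at hn
      exact hy' ⟨x, hn.le, hx⟩)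
  exact ⟨g, g.contMDiff.contDiff, fun x => mem_iInter₂.1 (hg (f x)) x rfl⟩

theorem finrank_le_of_isEpsEmbedding_closedBall [FiniteDimensional ℝ F] {N k : ℕ} {ε ρ : ℝ}
    (hε : 0 ≤ ε) (hερ : ε < ρ) {K : Geometry.SimplicialComplex ℝ (EuclideanSpace ℝ (Fin N))}
    (hK : IsPolyhedralOfDim K k) {f : closedBall (0 : F) ρ → K.space} (hf : IsEpsEmbedding ε f) :
    finrank ℝ F ≤ k := by
  by_contra! hk
  have : ProperSpace F := FiniteDimensional.proper_real F
  obtain ⟨ε', hεε', hε'ρ⟩ := exists_between hερ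
  obtain ⟨g, hg, hgf⟩ := exists_contDiff_dist_le_of_isEpsEmbedding hε hεε' hf
  -- The bound `‖a‖ < ρ - ε'` keeps `x - g (f x) + a` in the ball.
  obtain ⟨a, haρ, ha⟩ := (dense_compl_image_space hK hk hg).inter_open_nonempty
    (ball (0 : F) (ρ - ε')) isOpen_ball ⟨0, by simpa using hε'ρ⟩
  have hρ : 0 < ρ := hε.trans_lt hερ
  classical
  let h : F → F := fun x => if hx : x ∈ closedBall (0 : F) ρ then x - g (f ⟨x, hx⟩) + a else 0
  have hcont : ContinuousOn h (closedBall 0 ρ) := by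
    rw [continuousOn_iff_continuous_domRestrict]
    have : (closedBall (0 : F) ρ).domRestrict h =
        fun x : closedBall (0 : F) ρ => (x : F) - g (f x) + a := by
      ext x
      exact dif_pos x.2
    rw [this]
    exact (continuous_subtype_val.sub
      (hg.continuous.comp (continuous_subtype_val.comp hf.1))).add continuous_const
  obtain ⟨x, hx, hfix⟩ := exists_isFixedPt_of_mapsTo_closedBall hρ hcont fun x hx => by
    have h0 : h x = x - g (f ⟨x, hx⟩) + a := dif_pos hx
    rw [h0, mem_closedBall_zero_iff]
    have h1 := hgf ⟨x, hx⟩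
    rw [dist_comm, dist_eq_norm] at h1
    have h2 : ‖a‖ < ρ - ε' := mem_ball_zero_iff.1 haρ
    exact (norm_add_le_of_le h1 h2.le).trans (by linarith)
  have h0 : h x = x - g (f ⟨x, hx⟩) + a := dif_pos hx
  have h3 : x - g (f ⟨x, hx⟩) + a = x := h0.symm.trans hfix
  refine ha ⟨f ⟨x, hx⟩, (f ⟨x, hx⟩).2, ?_⟩
  generalize g (f ⟨x, hx⟩) = y at h3
  rw [sub_add_eq_add_sub, sub_eq_iff_eq_add, add_right_inj] at h3
  exact h3.symm

theorem finrank_le_widim_closedBall [FiniteDimensional ℝ F] {ε ρ : ℝ} (hε : 0 ≤ ε) (hερ : ε < ρ) :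
    (finrank ℝ F : ℕ∞) ≤ widim (closedBall (0 : F) ρ) ε := by
  refine le_sInf ?_
  rintro _ ⟨k, rfl, N, K, f, hK, hf⟩
  exact_mod_cast finrank_le_of_isEpsEmbedding_closedBall hε hερ hK hf

end LowerBound

/-! ### Comparison of width dimensions and barycentric upper bounds -/

theorem widim_le_widim_of_dist_le {X Y : Type*} [MetricSpace X] [MetricSpace Y] {ε : ℝ} {g : X → Y}
    (hg : Continuous g) (hd : ∀ x x', dist x x' ≤ dist (g x) (g x')) :
    widim X ε ≤ widim Y ε := by
  refine sInf_le_sInf ?_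
  rintro _ ⟨k, rfl, N, K, f, hK, hf⟩
  refine ⟨k, rfl, N, K, f ∘ g, hK, hf.1.comp hg, fun y => Metric.ediam_le fun x hx x' hx' => ?_⟩
  calc edist x x' ≤ edist (g x) (g x') := by
        rw [edist_dist, edist_dist]; exact ENNReal.ofReal_le_ofReal (hd x x')
    _ ≤ _ := (Metric.edist_le_ediam_of_mem (s := f ⁻¹' {y}) hx hx').trans (hf.2 y)

/-- The `m`-skeleton of the simplex spanned by a finite affinely independent family. -/
noncomputable def simplexSkeleton {E ι : Type*} [AddCommGroup E] [Module ℝ E] {v : ι → E}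
    (hv : AffineIndependent ℝ v) (m : ℕ) : Geometry.SimplicialComplex ℝ E :=
  open Classical in
  Geometry.SimplicialComplex.ofAffineIndependent
    { faces := {s | s.Nonempty ∧ (s : Set E) ⊆ Set.range v ∧ s.card ≤ m + 1}
      isRelLowerSet_faces := fun _ hs => ⟨hs.1, fun _ ht hne =>
        ⟨hne, (Finset.coe_subset.2 ht).trans hs.2.1, (Finset.card_le_card ht).trans hs.2.2⟩⟩ }
    (hv.range.mono (Set.iUnion₂_subset fun _ hs => hs.2.1))

theorem mem_faces_simplexSkeleton {E ι : Type*} [AddCommGroup E] [Module ℝ E] {v : ι → E}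
    {hv : AffineIndependent ℝ v} {m : ℕ} {s : Finset E} :
    s ∈ (simplexSkeleton hv m).faces ↔
      s.Nonempty ∧ (s : Set E) ⊆ Set.range v ∧ s.card ≤ m + 1 := Iff.rfl

/-- The exact dimension `k` drops below `m` when there are fewer than `m + 1` vertices. -/
theorem exists_isPolyhedralOfDim_simplexSkeleton {N : ℕ} {ι : Type*} [Finite ι] [Nonempty ι]
    {v : ι → EuclideanSpace ℝ (Fin N)} (hv : AffineIndependent ℝ v) (m : ℕ) :
    ∃ k ≤ m, IsPolyhedralOfDim (simplexSkeleton hv m) k := by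
  have hfin : (simplexSkeleton hv m).faces.Finite :=
    ((Set.finite_range v).toFinset.powerset : Set (Finset _)).toFinite.subset fun s hs => by
      simpa using hs.2.1
  have hne : (simplexSkeleton hv m).faces.Nonempty :=
    ⟨{v (Classical.arbitrary ι)}, mem_faces_simplexSkeleton.2 (by simp)⟩
  obtain ⟨s, hs, hmax⟩ := Set.exists_max_image _ Finset.card hfin hne
  have hpos : 0 < s.card := Finset.card_pos.2 hs.1
  have hcard : s.card ≤ m + 1 := hs.2.2
  refine ⟨s.card - 1, by omega, hfin, ⟨s, hs, by omega⟩, fun t ht => ?_⟩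
  have := hmax t ht
  omega

/-- A continuous family of barycentric coordinates with at most `m + 1` nonzero entries and small
fibres bounds the width dimension by `m`. -/
theorem widim_le_of_barycentric {X ι : Type*} [MetricSpace X] [Fintype ι] [Nonempty ι] {ε : ℝ}
    {m : ℕ} {w : X → ι → ℝ} (hc : Continuous w) (h0 : ∀ x i, 0 ≤ w x i) (h1 : ∀ x, ∑ i, w x i = 1)
    (hsupp : ∀ x, (Finset.univ.filter fun i => w x i ≠ 0).card ≤ m + 1)
    (hfib : ∀ x x', w x = w x' → dist x x' ≤ ε) : widim X ε ≤ m := by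
  classical
  let e := Fintype.equivFin ι
  -- With standard basis vectors as vertices, the weights are read off as coordinates, so fibres of
  -- `φ` are fibres of `w`.
  let v : ι → EuclideanSpace ℝ (Fin (Fintype.card ι)) := fun i => EuclideanSpace.single (e i) 1
  have hv : AffineIndependent ℝ v := by
    have h := (EuclideanSpace.basisFun (Fin (Fintype.card ι)) ℝ).toBasis.linearIndependent.comp
      e e.injective
    have hv' : v = (EuclideanSpace.basisFun (Fin (Fintype.card ι)) ℝ).toBasis ∘ e := by
      funext i
      simp [v]
    rw [hv']
    exact h.affineIndependent
  obtain ⟨k, hkm, hk⟩ := exists_isPolyhedralOfDim_simplexSkeleton hv m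
  let φ : X → EuclideanSpace ℝ (Fin (Fintype.card ι)) := fun x => ∑ i, w x i • v i
  have hφv : ∀ x j, φ x (e j) = w x j := by
    intro x j
    simp [φ, v, Finset.sum_apply, Pi.single_apply]
  have hφ : ∀ x, φ x ∈ (simplexSkeleton hv m).space := by
    intro x
    let s := Finset.univ.filter fun i => w x i ≠ 0
    have hs1 : ∑ i ∈ s, w x i = 1 := by rw [Finset.sum_filter_ne_zero, h1]
    have hsne : s.Nonempty := by
      by_contra hn
      rw [Finset.not_nonempty_iff_eq_empty.1 hn] at hs1
      simp at hs1
    refine Geometry.SimplicialComplex.mem_space_iff.2 ⟨s.image v,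
      mem_faces_simplexSkeleton.2 ⟨hsne.image v, ?_, Finset.card_image_le.trans (hsupp x)⟩, ?_⟩
    · rw [Finset.coe_image]; exact Set.image_subset_range _ _
    · have hsum : φ x = ∑ i ∈ s, w x i • v i := by
        refine (Finset.sum_subset (Finset.subset_univ _) fun i _ hi => ?_).symm
        have : w x i = 0 := by simpa [s] using hi
        simp [this]
      rw [hsum]
      exact (convex_convexHull ℝ _).sum_mem (fun i _ => h0 x i) hs1 fun i hi =>
        subset_convexHull ℝ _ (by exact_mod_cast Finset.mem_image_of_mem v hi)
  have hφc : Continuous φ :=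
    continuous_finsetSum _ fun i _ => ((continuous_apply i).comp hc).smul continuous_const
  refine le_trans (b := (k : ℕ∞)) (sInf_le ⟨k, rfl, _, simplexSkeleton hv m,
    fun x => ⟨φ x, hφ x⟩, hk, hφc.subtype_mk hφ, fun y => Metric.ediam_le fun x hx x' hx' => ?_⟩)
    (by exact_mod_cast hkm)
  rw [edist_dist]
  refine ENNReal.ofReal_le_ofReal (hfib x x' (funext fun j => ?_))
  have hxx : φ x = φ x' := congrArg Subtype.val ((hx : _ = y).trans (hx' : _ = y).symm)
  rw [← hφv, ← hφv, hxx]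

/-! ### Estimates for `ℓ^p` balls in the `ℓ^q` distance -/

section Balls

variable {p : ℝ} {q : ℝ≥0∞} {n : ℕ}

theorem continuous_toLp_cons :
    Continuous fun x : PiLp q fun _ : Fin n => ℝ =>
      WithLp.toLp q (Fin.cons 0 x : Fin (n + 1) → ℝ) := by
  refine (PiLp.continuous_toLp q _).comp (continuous_pi fun i => ?_)
  refine Fin.cases ?_ (fun j => ?_) i
  · exact continuous_const
  · simp only [Fin.cons_succ]; fun_prop

theorem cons_mem_lpBall (hp : 0 < p) {x : PiLp q fun _ : Fin n => ℝ} (hx : x ∈ lpBall p q n) :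
    WithLp.toLp q (Fin.cons 0 x : Fin (n + 1) → ℝ) ∈ lpBall p q (n + 1) := by
  change ∑ k : Fin (n + 1), |(Fin.cons 0 x : Fin (n + 1) → ℝ) k| ^ p ≤ 1
  rw [Fin.sum_univ_succ]
  have hx' : ∑ k, |x k| ^ p ≤ 1 := hx
  simpa [Real.zero_rpow hp.ne'] using hx'

theorem abs_apply_le_one (hp : 0 < p) {x : PiLp q fun _ : Fin n => ℝ} (hx : x ∈ lpBall p q n)
    (k : Fin n) : |x k| ≤ 1 := by
  by_contra! hlt
  have h : |x k| ^ p ≤ 1 := (Finset.single_le_sum (f := fun k => |x k| ^ p)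
    (fun i _ => by positivity) (Finset.mem_univ k)).trans hx
  exact h.not_gt (Real.one_lt_rpow hlt hp)

theorem card_filter_lt_abs_le (hp : 0 < p) {δ : ℝ} (hδ : 0 < δ)
    {x : PiLp q fun _ : Fin n => ℝ} (hx : x ∈ lpBall p q n) :
    (Finset.univ.filter fun k => δ < |x k|).card ≤ ⌊δ ^ (-p)⌋₊ := by
  refine Nat.le_floor ?_
  rw [Real.rpow_neg hδ.le, ← one_div, le_div_iff₀ (by positivity)]
  calc _ = ∑ k ∈ Finset.univ.filter fun k => δ < |x k|, δ ^ p := by simp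
    _ ≤ ∑ k ∈ Finset.univ.filter fun k => δ < |x k|, |x k| ^ p :=
      Finset.sum_le_sum fun k hk =>
        Real.rpow_le_rpow hδ.le (Finset.mem_filter.1 hk).2.le hp.le
    _ ≤ ∑ k, |x k| ^ p :=
      Finset.sum_le_sum_of_subset_of_nonneg (Finset.subset_univ _) fun _ _ _ => by positivity
    _ ≤ 1 := hx

variable [Fact (1 ≤ q)]

theorem dist_piLp_le_of_cons (x y : PiLp q fun _ : Fin n => ℝ) :
    dist x y ≤ dist (WithLp.toLp q (Fin.cons 0 x : Fin (n + 1) → ℝ))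
      (WithLp.toLp q (Fin.cons 0 y : Fin (n + 1) → ℝ)) := by
  rcases eq_or_ne q ∞ with rfl | hq
  · rw [dist_eq_norm, dist_eq_norm, PiLp.norm_eq_ciSup]
    refine Real.iSup_le (fun i => ?_) (norm_nonneg _)
    have h := PiLp.norm_apply_le (WithLp.toLp ∞ (Fin.cons 0 x : Fin (n + 1) → ℝ) -
      WithLp.toLp ∞ (Fin.cons 0 y : Fin (n + 1) → ℝ)) i.succ
    simpa using h
  · have hq0 : 0 < q.toReal := ENNReal.toReal_pos (zero_lt_one.trans_le Fact.out).ne' hq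
    rw [PiLp.dist_eq_sum hq0, PiLp.dist_eq_sum hq0, Fin.sum_univ_succ]
    simp [hq0.ne']

theorem monotone_widimBall (hp : 0 < p) (ε : ℝ) : Monotone fun n => widimBall p q n ε := by
  refine monotone_nat_of_le_succ fun n => ?_
  refine widim_le_widim_of_dist_le
    (g := fun x : lpBall p q n => (⟨WithLp.toLp q (Fin.cons 0 x.1 : Fin (n + 1) → ℝ),
      cons_mem_lpBall hp x.2⟩ : lpBall p q (n + 1)))
    ((continuous_toLp_cons.comp continuous_subtype_val).subtype_mk _)
    fun x y => dist_piLp_le_of_cons _ _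

/-- For finite `q` this is the power mean inequality with exponent `q/p`; the exponent on `ρ` is
`r`. -/
theorem closedBall_subset_lpBall (hp : 0 < p) (hpq : ENNReal.ofReal p < q) {ρ : ℝ}
    (hρ : 0 ≤ ρ) (hn : (n : ℝ) * ρ ^ (1 / (1 / p - (1 / q).toReal)) ≤ 1) :
    Metric.closedBall (0 : PiLp q fun _ : Fin n => ℝ) ρ ⊆ lpBall p q n := by
  intro x hx
  rw [mem_closedBall_zero_iff] at hx
  change ∑ k, |x k| ^ p ≤ 1
  rcases eq_or_ne q ∞ with rfl | hq
  · calc ∑ k, |x k| ^ p ≤ ∑ k : Fin n, ρ ^ p := Finset.sum_le_sum fun k _ =>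
          Real.rpow_le_rpow (abs_nonneg _) ((PiLp.norm_apply_le x k).trans hx) hp.le
      _ = n * ρ ^ p := by simp
      _ ≤ 1 := by simpa using hn
  · have hpq' : p < q.toReal := (ENNReal.ofReal_lt_iff_lt_toReal hp.le hq).1 hpq
    set Q := q.toReal
    have hQ : 0 < Q := hp.trans hpq'
    rcases Nat.eq_zero_or_pos n with rfl | hn0
    · simp
    have hn0' : (0 : ℝ) < n := by exact_mod_cast hn0
    have hsumQ : ∑ k, |x k| ^ Q ≤ ρ ^ Q := by
      rw [PiLp.norm_eq_sum hQ] at hx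
      have h := Real.rpow_le_rpow (by positivity) hx hQ.le
      rw [← Real.rpow_mul (by positivity), one_div, inv_mul_cancel₀ hQ.ne', Real.rpow_one] at h
      exact h
    -- Raise the hypothesis to the power `Q / p - 1`, using `r * (Q / p - 1) = Q`.
    have hpow : (n : ℝ) ^ (Q / p - 1) * ρ ^ Q ≤ 1 := by
      have h := Real.rpow_le_rpow (by positivity) hn
        (show 0 ≤ Q / p - 1 from sub_nonneg.2 ((one_le_div hp).2 hpq'.le))
      rw [Real.mul_rpow hn0'.le (by positivity), ← Real.rpow_mul hρ, Real.one_rpow] at h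
      convert h using 3
      rw [one_div q, ENNReal.toReal_inv]
      have : Q - p ≠ 0 := (sub_pos.2 hpq').ne'
      change Q = 1 / (1 / p - Q⁻¹) * (Q / p - 1)
      field_simp
    have hmean := Real.rpow_sum_le_const_mul_sum_rpow_of_nonneg Finset.univ
      (f := fun k => |x k| ^ p) (p := Q / p) ((one_le_div hp).2 hpq'.le) fun k _ => by positivity
    simp only [← Real.rpow_mul (abs_nonneg _), mul_div_cancel₀ _ hp.ne', Finset.card_univ,
      Fintype.card_fin] at hmean
    have hle : (∑ k, |x k| ^ p) ^ (Q / p) ≤ 1 := by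
      calc (∑ k, |x k| ^ p) ^ (Q / p) ≤ (n : ℝ) ^ (Q / p - 1) * ∑ k, |x k| ^ Q := hmean
        _ ≤ (n : ℝ) ^ (Q / p - 1) * ρ ^ Q := by gcongr
        _ ≤ 1 := hpow
    by_contra! hgt
    exact hle.not_gt (Real.one_lt_rpow hgt (div_pos hQ hp))

theorem le_widimBall (hp : 0 < p) (hpq : ENNReal.ofReal p < q) {ε ρ : ℝ} (hε : 0 ≤ ε) (hερ : ε < ρ)
    (hn : (n : ℝ) * ρ ^ (1 / (1 / p - (1 / q).toReal)) ≤ 1) : (n : ℕ∞) ≤ widimBall p q n ε := by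
  have h1 := finrank_le_widim_closedBall (F := PiLp q fun _ : Fin n => ℝ) hε hερ
  have h2 : Module.finrank ℝ (PiLp q fun _ : Fin n => ℝ) = n := by
    rw [(WithLp.linearEquiv q ℝ (Fin n → ℝ)).finrank_eq]; simp
  rw [h2] at h1
  exact h1.trans (widim_le_widim_of_dist_le
    (g := Set.inclusion (closedBall_subset_lpBall hp hpq (hε.trans hερ.le) hn))
    (continuous_inclusion _) fun _ _ => le_rfl)

/-- Soft thresholding at level `δ`. -/
noncomputable def softThreshold (δ a : ℝ) : ℝ := max (a - δ) 0 - max (-a - δ) 0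

theorem abs_sub_softThreshold_le {δ : ℝ} (hδ : 0 ≤ δ) (a : ℝ) :
    |a - softThreshold δ a| ≤ min δ |a| := by
  unfold softThreshold
  grind

/-- Each coordinate error `c` is at most both `δ` and `|x k|`, so `c ^ Q ≤ δ ^ (Q - p) * |x k| ^ p`,
which sums to at most `δ ^ (Q - p)`. -/
theorem norm_sub_softThreshold_le (hp : 0 < p) (hpq : ENNReal.ofReal p < q) {δ : ℝ} (hδ : 0 < δ)
    {x : PiLp q fun _ : Fin n => ℝ} (hx : x ∈ lpBall p q n) :
    ‖x - WithLp.toLp q fun k => softThreshold δ (x k)‖ ≤ δ ^ (1 - p * (1 / q).toReal) := by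
  have hk : ∀ k, ‖(x - WithLp.toLp q fun k => softThreshold δ (x k)) k‖ ≤ min δ |x k| := fun k =>
    abs_sub_softThreshold_le hδ.le (x k)
  rcases eq_or_ne q ∞ with rfl | hq
  · rw [PiLp.norm_eq_ciSup]
    refine Real.iSup_le (fun k => ?_) (by positivity)
    simpa using (hk k).trans (min_le_left _ _)
  · have hpq' : p < q.toReal := (ENNReal.ofReal_lt_iff_lt_toReal hp.le hq).1 hpq
    have hQ : 0 < q.toReal := hp.trans hpq'
    rw [PiLp.norm_eq_sum hQ, one_div q, ENNReal.toReal_inv]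
    set Q := q.toReal
    have hsum : ∑ k, ‖(x - WithLp.toLp q fun k => softThreshold δ (x k)) k‖ ^ Q ≤ δ ^ (Q - p) := by
      calc _ ≤ ∑ k, δ ^ (Q - p) * |x k| ^ p := Finset.sum_le_sum fun k _ => by
            have h := hk k
            set c := ‖(x - WithLp.toLp q fun k => softThreshold δ (x k)) k‖
            have hc : 0 ≤ c := norm_nonneg _
            calc c ^ Q = c ^ ((Q - p) + p) := by ring_nf
              _ = c ^ (Q - p) * c ^ p :=
                Real.rpow_add_of_nonneg hc (sub_nonneg.2 hpq'.le) hp.le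
              _ ≤ _ := mul_le_mul
                (Real.rpow_le_rpow hc (h.trans (min_le_left _ _)) (sub_nonneg.2 hpq'.le))
                (Real.rpow_le_rpow hc (h.trans (min_le_right _ _)) hp.le) (by positivity)
                (by positivity)
        _ = δ ^ (Q - p) * ∑ k, |x k| ^ p := by rw [Finset.mul_sum]
        _ ≤ δ ^ (Q - p) * 1 := by gcongr; exact hx
        _ = _ := mul_one _
    calc _ ≤ (δ ^ (Q - p)) ^ (1 / Q) := Real.rpow_le_rpow (by positivity) hsum (by positivity)
      _ = _ := by
        rw [← Real.rpow_mul hδ.le]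
        congr 1
        field_simp

/-- Barycentric coordinates of the soft thresholding of `x`, split into positive and negative
parts. -/
noncomputable def thresholdWeights (δ : ℝ) (x : PiLp q fun _ : Fin n => ℝ) :
    Option (Fin n × Bool) → ℝ
  | none => 1 - ∑ k : Fin n, (max (x k - δ) 0 + max (-x k - δ) 0) / (n + 1)
  | some (k, true) => max (x k - δ) 0 / (n + 1)
  | some (k, false) => max (-x k - δ) 0 / (n + 1)

theorem widimBall_le (hp : 0 < p) (hpq : ENNReal.ofReal p < q) {δ ε : ℝ} (hδ : 0 < δ)
    (hδε : 2 * δ ^ (1 - p * (1 / q).toReal) ≤ ε) : widimBall p q n ε ≤ ⌊δ ^ (-p)⌋₊ := by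
  have hn1 : (0 : ℝ) < n + 1 := by positivity
  refine widim_le_of_barycentric (w := fun x => thresholdWeights δ x.1) ?_ ?_ ?_ ?_ ?_
  · refine continuous_pi fun i => ?_
    rcases i with _ | ⟨k, _ | _⟩ <;> simp only [thresholdWeights] <;> fun_prop
  · rintro x (_ | ⟨k, _ | _⟩) <;> simp only [thresholdWeights]
    -- On the ball each coordinate contributes at most `1 / (n + 1)`, so the slack vertex keeps a
    -- nonnegative weight.
    · rw [sub_nonneg]
      calc _ ≤ ∑ k : Fin n, 1 / ((n : ℝ) + 1) := Finset.sum_le_sum fun k _ => by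
            have h := abs_apply_le_one hp x.2 k
            gcongr
            rw [abs_le] at h
            grind
        _ = n / (n + 1) := by simp [div_eq_mul_inv]
        _ ≤ 1 := by rw [div_le_one hn1]; linarith
    · positivity
    · positivity
  · intro x
    rw [Fintype.sum_option, Fintype.sum_prod_type]
    simp [thresholdWeights, add_div]
  · intro x
    -- Each surviving coordinate uses only the vertex of its sign; the slack vertex `none` is the
    -- extra `+ 1`.
    classical
    refine (Finset.card_le_card (t := insert none (((Finset.univ.filter fun k => δ < |x.1 k|).image
      fun k => (some (k, decide (0 < x.1 k)))))) ?_).trans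
      ((Finset.card_insert_le _ _).trans (Nat.add_le_add_right
        (Finset.card_image_le.trans (card_filter_lt_abs_le hp hδ x.2)) 1))
    rintro (_ | ⟨k, _ | _⟩) hi <;> simp [thresholdWeights, hn1.ne'] at hi ⊢
    · exact ⟨by grind, by grind⟩
    · exact ⟨by grind, by grind⟩
  · intro x x' hxx
    have hT : (WithLp.toLp q fun k => softThreshold δ (x.1 k)) =
        WithLp.toLp q fun k => softThreshold δ (x'.1 k) := by
      congr 1
      funext k
      have h1 := congrFun hxx (some (k, true))
      have h2 := congrFun hxx (some (k, false))
      simp only [thresholdWeights] at h1 h2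
      rw [softThreshold, softThreshold, (div_left_inj' hn1.ne').1 h1, (div_left_inj' hn1.ne').1 h2]
    have h1 := norm_sub_softThreshold_le hp hpq hδ x.2
    have h2 := norm_sub_softThreshold_le hp hpq hδ x'.2
    rw [← dist_eq_norm] at h1 h2
    rw [← hT, dist_comm] at h2
    exact (dist_triangle x.1 _ x'.1).trans (by linarith)

end Balls

/-! ### Logarithmic bounds and the limit -/

theorem log_widimBall_le {p r : ℝ} {q : ℝ≥0∞} [Fact (1 ≤ q)] (hp : 0 < p)
    (hpq : ENNReal.ofReal p < q) (hr0 : 0 < r) (hr : 1 / r = 1 / p - (1 / q).toReal) (n : ℕ) {ε : ℝ}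
    (hε : 0 < ε) :
    ENNReal.log (widimBall p q n ε : ℝ≥0∞) ≤ ((r * (Real.log 2 - Real.log ε) : ℝ) : EReal) := by
  -- This `δ` solves `2 * δ ^ (1 - p/q) = ε`, since `1 - p/q = p/r`.
  have hδ : 0 < (ε / 2) ^ (r / p) := by positivity
  have hexp : r / p * (1 - p * (1 / q).toReal) = 1 := by
    rw [show (1 / q).toReal = 1 / p - 1 / r by linarith]
    field_simp
    ring
  have h := widimBall_le (n := n) (ε := ε) hp hpq hδ
    (by rw [← Real.rpow_mul (by positivity), hexp, Real.rpow_one]; linarith)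
  rw [← Real.rpow_mul (by positivity), show r / p * -p = -r by field_simp] at h
  have h2 : (widimBall p q n ε : ℝ≥0∞) ≤ ENNReal.ofReal ((ε / 2) ^ (-r)) := by
    calc (widimBall p q n ε : ℝ≥0∞) ≤ ((⌊(ε / 2) ^ (-r)⌋₊ : ℕ∞) : ℝ≥0∞) :=
          ENat.toENNReal_le.2 h
      _ = ENNReal.ofReal (⌊(ε / 2) ^ (-r)⌋₊ : ℝ) := by simp
      _ ≤ _ := ENNReal.ofReal_le_ofReal (Nat.floor_le (by positivity))
  calc _ ≤ ENNReal.log (ENNReal.ofReal ((ε / 2) ^ (-r))) := ENNReal.log_monotone h2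
    _ = _ := by
      rw [ENNReal.log_ofReal_of_pos (by positivity), Real.log_rpow (by positivity),
        Real.log_div hε.ne' two_ne_zero]
      congr 1
      ring

theorem exists_le_log_widimBall {p r : ℝ} {q : ℝ≥0∞} [Fact (1 ≤ q)] (hp : 0 < p)
    (hpq : ENNReal.ofReal p < q) (hr0 : 0 < r) (hr : 1 / r = 1 / p - (1 / q).toReal) {ε : ℝ}
    (hε : 0 < ε) (hε2 : 2 ≤ ε ^ (-r)) :
    ∃ n : ℕ, ((-r * Real.log ε - Real.log 2 : ℝ) : EReal) ≤
      ENNReal.log (widimBall p q n ε : ℝ≥0∞) := by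
  set a := ε ^ (-r) with ha
  -- `n` is the largest integer strictly below `a`: strictness gives a radius `n ^ (-1 / r) > ε`,
  -- and `a ≥ 2` gives `n ≥ a - 1 ≥ a / 2`.
  obtain ⟨n, hn⟩ : ∃ n, ⌈a⌉₊ = n + 1 :=
    Nat.exists_eq_succ_of_ne_zero (Nat.ceil_pos.2 (by linarith)).ne'
  have hna : (n : ℝ) < a := Nat.lt_ceil.1 (by omega)
  have han : a ≤ n + 1 := by
    have := Nat.le_ceil a
    rw [hn] at this
    exact_mod_cast this
  have hn1 : (1 : ℝ) ≤ n := by linarith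
  have hn0 : (0 : ℝ) < n := by linarith
  have hερ : ε < (n : ℝ) ^ (-1 / r) := by
    have h := Real.rpow_lt_rpow_of_neg hn0 hna (show -1 / r < 0 from div_neg_of_neg_of_pos
      (by norm_num) hr0)
    rwa [ha, ← Real.rpow_mul hε.le, show -r * (-1 / r) = 1 by field_simp, Real.rpow_one] at h
  have h := le_widimBall (n := n) hp hpq hε.le hερ (by
    rw [← hr, ← Real.rpow_mul hn0.le, show -1 / r * (1 / (1 / r)) = -1 by field_simp,
      Real.rpow_neg_one, mul_inv_cancel₀ hn0.ne'])
  refine ⟨n, ?_⟩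
  have h2 : ENNReal.ofReal (a / 2) ≤ (widimBall p q n ε : ℝ≥0∞) := by
    calc ENNReal.ofReal (a / 2) ≤ ENNReal.ofReal n := ENNReal.ofReal_le_ofReal (by linarith)
      _ = ((n : ℕ∞) : ℝ≥0∞) := by simp
      _ ≤ _ := ENat.toENNReal_le.2 h
  calc _ = ENNReal.log (ENNReal.ofReal (a / 2)) := by
        rw [ENNReal.log_ofReal_of_pos (by positivity), Real.log_div (by positivity) two_ne_zero,
          Real.log_rpow hε]
    _ ≤ _ := ENNReal.log_monotone h2

theorem corollary3 (p : ℝ) (q : ℝ≥0∞) [Fact (1 ≤ q)] (hp : 1 ≤ p) (hpq : ENNReal.ofReal p < q)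
    (r : ℝ) (hr : 1 / r = 1 / p - (1 / q).toReal) :
    (q ≠ ∞ → r = p * q.toReal / (q.toReal - p)) ∧ (q = ∞ → r = p) ∧
    (∀ ε : ℝ, 0 < ε →
      Monotone (fun n : ℕ => widimBall p q n ε) ∧
      (∃ C : ℕ, ∀ n : ℕ, widimBall p q n ε ≤ C) ∧
      ∃ l : EReal,
        Tendsto (fun n : ℕ => ENNReal.log (widimBall p q n ε : ℝ≥0∞)) atTop (𝓝 l)) ∧
    ∃ L : ℝ → EReal,
      (∀ ε : ℝ, 0 < ε → ε ≠ 1 →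
        Tendsto (fun n : ℕ =>
          ENNReal.log (widimBall p q n ε : ℝ≥0∞) / ((|Real.log ε| : ℝ) : EReal))
          atTop (𝓝 (L ε))) ∧
      Tendsto L (𝓝[>] 0) (𝓝 (r : EReal)) := by
  have hp0 : 0 < p := one_pos.trans_le hp
  have hfin : q ≠ ∞ → p < q.toReal ∧ r = p * q.toReal / (q.toReal - p) := by
    intro hq
    have hpq' : p < q.toReal := (ENNReal.ofReal_lt_iff_lt_toReal hp0.le hq).1 hpq
    refine ⟨hpq', ?_⟩
    have hq0 : q.toReal ≠ 0 := (hp0.trans hpq').ne'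
    rw [one_div q, ENNReal.toReal_inv] at hr
    rw [← one_div_one_div r, hr]
    have : q.toReal - p ≠ 0 := (sub_pos.2 hpq').ne'
    field_simp
  have hinf : q = ∞ → r = p := by
    rintro rfl
    simpa using hr
  have hr0 : 0 < r := by
    rcases eq_or_ne q ∞ with hq | hq
    · rw [hinf hq]; exact hp0
    · obtain ⟨h1, h2⟩ := hfin hq
      rw [h2]
      exact div_pos (mul_pos hp0 (hp0.trans h1)) (sub_pos.2 h1)
  have hmono : ∀ ε : ℝ, Monotone fun n : ℕ => ENNReal.log (widimBall p q n ε : ℝ≥0∞) := fun ε =>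
    ENNReal.log_monotone.comp (ENat.toENNReal_mono.comp (monotone_widimBall hp0 ε))
  have hmono' : ∀ ε : ℝ, Monotone fun n : ℕ =>
      ENNReal.log (widimBall p q n ε : ℝ≥0∞) / ((|Real.log ε| : ℝ) : EReal) := fun ε m n hmn =>
    EReal.div_le_div_right_of_nonneg (by exact_mod_cast abs_nonneg _) (hmono ε hmn)
  -- By monotonicity in `n` the inner limits are suprema, so one good `n` suffices for the lower
  -- bound and a bound uniform in `n` for the upper.
  refine ⟨fun hq => (hfin hq).2, hinf, fun ε hε => ⟨monotone_widimBall hp0 ε, ?_,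
    _, tendsto_atTop_iSup (hmono ε)⟩, _, fun ε _ _ => tendsto_atTop_iSup (hmono' ε), ?_⟩
  · have hs : 0 < 1 - p * (1 / q).toReal := by
      have : p * (1 / r) = 1 - p * (1 / q).toReal := by rw [hr]; field_simp
      rw [← this]; positivity
    exact ⟨_, fun n => widimBall_le hp0 hpq
      (δ := (ε / 2) ^ (1 / (1 - p * (1 / q).toReal))) (by positivity) (by
        rw [← Real.rpow_mul (by positivity), one_div_mul_cancel hs.ne', Real.rpow_one]; linarith)⟩
  have hlog : Tendsto (fun ε : ℝ => Real.log 2 / -Real.log ε) (𝓝[>] 0) (𝓝 0) :=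
    (tendsto_neg_atBot_atTop.comp Real.tendsto_log_nhdsGT_zero).const_div_atTop _
  have hlow : Tendsto (fun ε : ℝ => ((r - Real.log 2 / -Real.log ε : ℝ) : EReal)) (𝓝[>] 0)
      (𝓝 (r : EReal)) := by
    refine EReal.tendsto_coe.2 ?_
    simpa using tendsto_const_nhds.sub hlog
  have hup : Tendsto (fun ε : ℝ => ((r + r * (Real.log 2 / -Real.log ε) : ℝ) : EReal)) (𝓝[>] 0)
      (𝓝 (r : EReal)) := by
    refine EReal.tendsto_coe.2 ?_
    simpa using tendsto_const_nhds.add (hlog.const_mul r)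
  have hsmall : ∀ᶠ ε : ℝ in 𝓝[>] 0, 0 < ε ∧ Real.log ε < 0 ∧ 2 ≤ ε ^ (-r) := by
    have h2 : Tendsto (fun ε : ℝ => ε ^ (-r)) (𝓝[>] 0) atTop :=
      tendsto_rpow_neg_nhdsGT_zero (neg_lt_zero.2 hr0)
    filter_upwards [self_mem_nhdsWithin, Real.tendsto_log_nhdsGT_zero.eventually_lt_atBot 0,
      h2.eventually_ge_atTop 2] with ε h1 h2 h3 using ⟨h1, h2, h3⟩
  refine tendsto_of_tendsto_of_tendsto_of_le_of_le' hlow hup ?_ ?_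
  · filter_upwards [hsmall] with ε ⟨hε, hlogε, hε2⟩
    obtain ⟨n, hn⟩ := exists_le_log_widimBall hp0 hpq hr0 hr hε hε2
    refine le_trans ?_ (le_iSup _ n)
    refine le_trans (le_of_eq ?_)
      (EReal.div_le_div_right_of_nonneg (by exact_mod_cast abs_nonneg (Real.log ε)) hn)
    rw [← EReal.coe_div, abs_of_neg hlogε]
    congr 1
    have := hlogε.ne
    field_simp
    ring
  · filter_upwards [hsmall] with ε ⟨hε, hlogε, _⟩
    refine iSup_le fun n => ?_
    refine (EReal.div_le_div_right_of_nonneg (by exact_mod_cast abs_nonneg (Real.log ε))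
      (log_widimBall_le hp0 hpq hr0 hr n hε)).trans (le_of_eq ?_)
    rw [← EReal.coe_div, abs_of_neg hlogε]
    congr 1
    have := hlogε.ne
    field_simp
    ring
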